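/- Let $n\ge 1$ and consider a half-space made of $n+1$ layers with shear moduli $\mu_j>0$, densities $\rho_j>0$ ($1\le j\le n+1$) and interfaces $0=H_1<H_2<\dots<H_{n+1}$, $H_{n+2}:=+\infty$, layer $j$ occupying the depths $[H_j,H_{j+1})$. Put $C_j=\sqrt{\mu_j/\rho_j}$, $T_j=H_{j+1}-H_j\in(0,+\infty]$, $C_\infty=C_{n+1}$, $C_0=\min_j C_j$, and assume $C_0<C_\infty$. For $\omega>0$ and $k\in\mathbb R$ let $\nu_j(\omega,k)=C_j^{-1}\sqrt{C_j^2k^2-\omega^2}$, and for $y\in\mathbb R$ let $\bar\nu_j(y)=\sqrt{y^2-C_j^{-2}}$, the square roots being taken with nonpositive imaginary part. Define $(P_0,Q_0)=(1,0)$ and, for $1\le m\le n$, $$\begin{pmatrix}P_m\\Q_m\end{pmatrix}=M_m\begin{pmatrix}P_{m-1}\\Q_{m-1}\end{pmatrix},\qquad M_m=\begin{pmatrix}\cosh(\nu_mT_m)&\dfrac{\sinh(\nu_mT_m)}{\mu_m\nu_m}\\ \mu_m\nu_m\sinh(\nu_mT_m)&\cosh(\nu_mT_m)\end{pmatrix},$$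 with $M_m=\begin{pmatrix}1&T_m/\mu_m\\0&1\end{pmatrix}$ when $\nu_m=0$, and $f_n=\mu_{n+1}\nu_{n+1}P_n+Q_n$. For $\omega>0$ let $k_1(\omega)>k_2(\omega)>\cdots$ be the decreasingly ordered values $k\in\mathbb R$ that solve the dispersion relation $f_n(\omega,k)=0$, with $k_\ell(\omega)=-\infty$ if there is no $\ell$-th one, and let $$N(\omega,y)=\#\{\ell\ge1:\ k_\ell(\omega)/\omega\ge y\}.$$ Let $\sigma$ be a permutation of $\{1,\dots,n+1\}$ such that $\widetilde C_j:=C_{\sigma(j)}$ is nondecreasing in $j$, and put $\tilde\nu_j=\bar\nu_{\sigma(j)}$, $\widetilde T_j=T_{\sigma(j)}$. Here $N(\omega,y)\sim g(\omega)$ means that the ratio tends to $1$ as $\omega\to+\infty$, for $y$ fixed. Then: - If $n=1$, then for every $y\in[1/C_\infty,1/C_0)$, $$N(\omega,y)\sim\frac{\omega}{\pi}|\tilde\nu_1(y)|\widetilde T_1 .$$ - If $n=2$, then for every $y\in[1/C_\infty,1/C_0)$, $$N(\omega,y)\sim\frac{\omega}{\pi}|\tilde\nu_1(y)|\widetilde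 T_1\quad\text{if } y\in[1/\widetilde C_2,1/C_0),$$ $$N(\omega,y)\sim\frac{\omega}{\pi}\bigl(|\tilde\nu_1(y)|\widetilde T_1+|\tilde\nu_2(y)|\widetilde T_2\bigr)\quad\text{if } y\in[1/C_\infty,1/\widetilde C_2).$$ - If $n\ge3$ and $C_0<\widetilde C_2$, then for every $y\in[1/\widetilde C_2,1/C_0)$, $$N(\omega,y)\sim\frac{\omega}{\pi}|\tilde\nu_1(y)|\widetilde T_1 .$$ -/

import Mathlib

/-- A stratified elastic half-space made of `n + 1` homogeneous layers. Layers are indexed by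
`Fin (n + 1)`, from the surface downwards: index `j` stands for the layer number `j + 1`.
`H j` is the depth of the top of layer `j`, so layer `j` occupies `[H j, H (j + 1))`, and the last
one occupies `[H n, +∞)`. -/
structure LayeredMedium (n : ℕ) where
  /-- shear modulus of each layer -/
  μ : Fin (n + 1) → ℝ
  /-- density of each layer -/
  ρ : Fin (n + 1) → ℝ
  /-- depth of the top of each layer -/
  H : Fin (n + 1) → ℝ
  μ_pos : ∀ j, 0 < μ j
  ρ_pos : ∀ j, 0 < ρ j
  H_zero : H 0 = 0
  H_strictMono : StrictMono H

/-- The complex square root of a real number `x`, with nonpositive imaginary part: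
`√x` if `0 ≤ x`, and `-i √(-x)` if `x ≤ 0` (the real square root vanishes on negative numbers). -/
noncomputable def lowerSqrt (x : ℝ) : ℂ :=
  (Real.sqrt x : ℂ) - Complex.I * (Real.sqrt (-x) : ℂ)

theorem lowerSqrt_im_nonpos (x : ℝ) : (lowerSqrt x).im ≤ 0 := by
  simp [lowerSqrt, Real.sqrt_nonneg]

theorem lowerSqrt_sq (x : ℝ) : lowerSqrt x ^ 2 = (x : ℂ) := by
  rcases le_total 0 x with h | h
  · have h0 : Real.sqrt (-x) = 0 := Real.sqrt_eq_zero_of_nonpos (by linarith)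
    have h1 : ((Real.sqrt x : ℝ) : ℂ) ^ 2 = (x : ℂ) := by
      rw [← Complex.ofReal_pow, Real.sq_sqrt h]
    simp [lowerSqrt, h0, h1]
  · have h0 : Real.sqrt x = 0 := Real.sqrt_eq_zero_of_nonpos h
    have h1 : ((Real.sqrt (-x) : ℝ) : ℂ) ^ 2 = ((-x : ℝ) : ℂ) := by
      rw [← Complex.ofReal_pow, Real.sq_sqrt (by linarith)]
    simp only [lowerSqrt, h0, Complex.ofReal_zero, zero_sub, neg_sq, mul_pow, Complex.I_sq, h1]
    simp

namespace LayeredMedium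

/-- The shear wave velocity of layer `j`. -/
noncomputable def C {n : ℕ} (m : LayeredMedium n) (j : Fin (n + 1)) : ℝ :=
  Real.sqrt (m.μ j / m.ρ j)

/-- The velocity in the semi-infinite layer. -/
noncomputable def Cinf {n : ℕ} (m : LayeredMedium n) : ℝ := m.C (Fin.last n)

/-- The minimal velocity. -/
noncomputable def C0 {n : ℕ} (m : LayeredMedium n) : ℝ :=
  Finset.univ.inf' Finset.univ_nonempty m.C

/-- The (finite) thickness of a layer other than the last one. -/
def width {n : ℕ} (m : LayeredMedium n) (i : Fin n) : ℝ := m.H i.succ - m.H i.castSucc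

/-- The thickness of an arbitrary layer; it is infinite for the last one. -/
noncomputable def T {n : ℕ} (m : LayeredMedium n) (j : Fin (n + 1)) : EReal :=
  Fin.lastCases (motive := fun _ => EReal) ⊤ (fun i => (m.width i : EReal)) j

theorem T_last {n : ℕ} (m : LayeredMedium n) : m.T (Fin.last n) = ⊤ := by simp [T]

theorem T_castSucc {n : ℕ} (m : LayeredMedium n) (i : Fin n) :
    m.T i.castSucc = (m.width i : EReal) := by simp [T]

/-- `ν_j(ω, k) = C_j⁻¹ √(C_j² k² - ω²)`, with nonpositive imaginary part. -/
noncomputable def ν {n : ℕ} (m : LayeredMedium n) (j : Fin (n + 1)) (ω k : ℝ) : ℂ :=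
  ((m.C j)⁻¹ : ℝ) * lowerSqrt (m.C j ^ 2 * k ^ 2 - ω ^ 2)

/-- `ν̄_j(y) = √(y² - C_j⁻²)`, with nonpositive imaginary part. -/
noncomputable def νbar {n : ℕ} (m : LayeredMedium n) (j : Fin (n + 1)) (y : ℝ) : ℂ :=
  lowerSqrt (y ^ 2 - (m.C j ^ 2)⁻¹)

open Classical in
/-- The transfer matrix of the layer `i` (a layer of finite thickness). -/
noncomputable def transfer {n : ℕ} (m : LayeredMedium n) (i : Fin n) (ω k : ℝ) :
    Matrix (Fin 2) (Fin 2) ℂ :=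
  if m.ν i.castSucc ω k = 0 then
    !![1, (m.width i : ℂ) / (m.μ i.castSucc : ℂ);
       0, 1]
  else
    !![Complex.cosh (m.ν i.castSucc ω k * m.width i),
         Complex.sinh (m.ν i.castSucc ω k * m.width i) / (m.μ i.castSucc * m.ν i.castSucc ω k);
       m.μ i.castSucc * m.ν i.castSucc ω k * Complex.sinh (m.ν i.castSucc ω k * m.width i),
         Complex.cosh (m.ν i.castSucc ω k * m.width i)]

/-- The vectors `(P_j, Q_j)`, `0 ≤ j ≤ n`: `(P_0, Q_0) = (1, 0)`, and `(P_j, Q_j)` is the image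
of `(P_{j-1}, Q_{j-1})` under the transfer matrix of the `j`-th layer. -/
noncomputable def PQ {n : ℕ} (m : LayeredMedium n) (ω k : ℝ) (j : Fin (n + 1)) : Fin 2 → ℂ :=
  Fin.induction (motive := fun _ => Fin 2 → ℂ) ![1, 0]
    (fun i v => Matrix.mulVec (m.transfer i ω k) v) j

/-- The dispersion function `f_n = μ_∞ ν_∞ P_n + Q_n`. -/
noncomputable def f {n : ℕ} (m : LayeredMedium n) (ω k : ℝ) : ℂ :=
  m.μ (Fin.last n) * m.ν (Fin.last n) ω k * m.PQ ω k (Fin.last n) 0 + m.PQ ω k (Fin.last n) 1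

/-- The real solutions `k` of the dispersion relation at frequency `ω`. -/
def wavenumbers {n : ℕ} (m : LayeredMedium n) (ω : ℝ) : Set ℝ := {k | m.f ω k = 0}

/-- `k_ℓ(ω)`: the `ℓ`-th largest solution of the dispersion relation, i.e. the solution with
exactly `ℓ - 1` larger ones. There is at most one such solution; if there is none, the supremum is
that of the empty set, so that `k_ℓ(ω) = -∞`. -/
noncomputable def branch {n : ℕ} (m : LayeredMedium n) (ℓ : ℕ) (ω : ℝ) : EReal :=
  sSup {x : EReal | ∃ k ∈ m.wavenumbers ω,
    {k' ∈ m.wavenumbers ω | k < k'}.encard + 1 = (ℓ : ℕ∞) ∧ x = (k : EReal)}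

/-- `N(ω, y)`: the number of indices `ℓ ≥ 1` such that `k_ℓ(ω) / ω ≥ y`. -/
noncomputable def N {n : ℕ} (m : LayeredMedium n) (ω y : ℝ) : ℕ :=
  {ℓ : ℕ | 1 ≤ ℓ ∧ (y : EReal) ≤ m.branch ℓ ω / (ω : EReal)}.ncard

end LayeredMedium

/-! Each vertical wavenumber has a real square `l = k² - ω²/C_j²`, and the entries of a transfer
matrix depend only on this square. So `(P, Q)` is a real solution of `P' = Q/μ`, `Q' = μ l P`, and
it never vanishes. Hence `P_n + i Q_n = exp L(k)` with `L` continuous in `k`; its imaginary part is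
a Prüfer angle `θ(k)`. For `k ≥ ω/C_∞` the dispersion relation reads `sin Φ = 0`, where `Φ = θ +
arctan(μ_{n+1} ν_{n+1})` (`f_eq_zero_iff`). The phase `Φ` is strictly increasing there: a Wronskian
identity makes `θ` nondecreasing (`IsPruferLog.im_monotoneOn`), and the arctangent increases
strictly. Once `k ≥ ω/C_0` every layer is evanescent, and `Φ` lies in `(0, π)`. Thus the solutions
`k ≥ yω` correspond to the multiples of `π` in `[Φ(yω), 0]`, and their number is `-Φ(yω)/π + O(1)`.
An oscillating layer turns the angle by `-√(-l) T` and an evanescent layer by `0`, each up to an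
error of at most `π`. Summing over the layers gives `abs_N_sub_le`: `N` equals `ω/π` times the sum
of `T_i √(C_i⁻² - y²)` over the finite layers with `C_i < 1/y`, up to an error at most `n + 2`. The
three cases only identify which layers contribute at the slowness `y`. -/

/-! ### Real fundamental solutions inside one layer -/

/-- The solution of `u'' = l u` with `u 0 = 1`, `u' 0 = 0`, for real `l` of any sign. -/
noncomputable def layerCos (l z : ℝ) : ℝ := Real.cosh (√l * z) * Real.cos (√(-l) * z)

/-- The solution of `u'' = l u` with `u 0 = 0`, `u' 0 = 1`, for real `l` of any sign. -/
noncomputable def layerSin (l z : ℝ) : ℝ := ∫ t in (0 : ℝ)..z, layerCos l t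

theorem continuous_layerCos : Continuous fun p : ℝ × ℝ => layerCos p.1 p.2 := by
  unfold layerCos
  exact (Real.continuous_cosh.comp (by fun_prop)).mul (Real.continuous_cos.comp (by fun_prop))

/-- Taking a primitive of `layerCos` instead of a quotient by `√l` gives joint continuity through
the turning value `l = 0` with no case distinction. -/
theorem continuous_layerSin : Continuous fun p : ℝ × ℝ => layerSin p.1 p.2 :=
  intervalIntegral.continuous_parametric_primitive_of_continuous (f := layerCos)
    continuous_layerCos

theorem continuous_layerCos_right (l : ℝ) : Continuous (layerCos l) :=
  continuous_layerCos.comp (Continuous.prodMk_right l)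

theorem hasDerivAt_layerSin (l z : ℝ) : HasDerivAt (layerSin l) (layerCos l z) z :=
  intervalIntegral.integral_hasDerivAt_right
    ((continuous_layerCos_right l).intervalIntegrable _ _)
    ((continuous_layerCos_right l).stronglyMeasurableAtFilter _ _)
    (continuous_layerCos_right l).continuousAt

@[simp] theorem layerCos_zero (l : ℝ) : layerCos l 0 = 1 := by simp [layerCos]

@[simp] theorem layerSin_zero (l : ℝ) : layerSin l 0 = 0 := by simp [layerSin]

theorem layerCos_of_nonneg {l : ℝ} (hl : 0 ≤ l) (z : ℝ) :
    layerCos l z = Real.cosh (√l * z) := by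
  simp [layerCos, Real.sqrt_eq_zero_of_nonpos (neg_nonpos.2 hl)]

theorem layerCos_of_nonpos {l : ℝ} (hl : l ≤ 0) (z : ℝ) :
    layerCos l z = Real.cos (√(-l) * z) := by
  simp [layerCos, Real.sqrt_eq_zero_of_nonpos hl]

theorem layerSin_zero_left (z : ℝ) : layerSin 0 z = z := by
  simp [layerSin, layerCos]

theorem eq_of_hasDerivAt_of_eq_zero {f g f' : ℝ → ℝ} (hf : ∀ z, HasDerivAt f (f' z) z)
    (hg : ∀ z, HasDerivAt g (f' z) z) (h0 : f 0 = g 0) (z : ℝ) : f z = g z := by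
  have h := is_const_of_deriv_eq_zero (f := fun z => f z - g z)
    (fun x => ((hf x).sub (hg x)).differentiableAt)
    (fun x => (((hf x).sub (hg x)).congr_deriv (sub_self _)).deriv) z 0
  simp only [h0, sub_self] at h
  linarith

theorem sqrt_mul_layerSin_of_nonneg {l : ℝ} (hl : 0 ≤ l) (z : ℝ) :
    √l * layerSin l z = Real.sinh (√l * z) := by
  refine eq_of_hasDerivAt_of_eq_zero (f := fun z => √l * layerSin l z)
    (f' := fun z => √l * layerCos l z)
    (g := fun z => Real.sinh (√l * z)) (fun z => (hasDerivAt_layerSin l z).const_mul _)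
    (fun z => ?_) (by simp) z
  have h := ((hasDerivAt_id z).const_mul (√l)).sinh
  simp only [id, mul_one] at h
  rwa [layerCos_of_nonneg hl, mul_comm]

theorem sqrt_mul_layerSin_of_nonpos {l : ℝ} (hl : l ≤ 0) (z : ℝ) :
    √(-l) * layerSin l z = Real.sin (√(-l) * z) := by
  refine eq_of_hasDerivAt_of_eq_zero (f := fun z => √(-l) * layerSin l z)
    (f' := fun z => √(-l) * layerCos l z)
    (g := fun z => Real.sin (√(-l) * z)) (fun z => (hasDerivAt_layerSin l z).const_mul _)
    (fun z => ?_) (by simp) z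
  have h := ((hasDerivAt_id z).const_mul (√(-l))).sin
  simp only [id, mul_one] at h
  rwa [layerCos_of_nonpos hl, mul_comm]

theorem hasDerivAt_layerCos (l z : ℝ) : HasDerivAt (layerCos l) (l * layerSin l z) z := by
  rcases le_total 0 l with hl | hl
  · have h := ((hasDerivAt_id z).const_mul (√l)).cosh
    simp only [id, mul_one] at h
    have e : layerCos l = fun z => Real.cosh (√l * z) := funext (layerCos_of_nonneg hl)
    rw [e]
    convert h using 1
    rw [← sqrt_mul_layerSin_of_nonneg hl]
    nth_rewrite 1 [← Real.mul_self_sqrt hl]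
    ring
  · have h := ((hasDerivAt_id z).const_mul (√(-l))).cos
    simp only [id, mul_one] at h
    have e : layerCos l = fun z => Real.cos (√(-l) * z) := funext (layerCos_of_nonpos hl)
    rw [e]
    convert h using 1
    rw [← sqrt_mul_layerSin_of_nonpos hl]
    have := Real.mul_self_sqrt (neg_nonneg.2 hl)
    linear_combination layerSin l z * this

/-- The left side has zero derivative in `z`. It is the determinant of the transfer matrix, so the
transfer is invertible. -/
theorem layerCos_sq_sub (l z : ℝ) : layerCos l z ^ 2 - l * layerSin l z ^ 2 = 1 := by
  refine eq_of_hasDerivAt_of_eq_zero (f := fun z => layerCos l z ^ 2 - l * layerSin l z ^ 2)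
    (f' := fun _ => 0) (g := fun _ => 1) (fun z => ?_) (fun z => hasDerivAt_const z 1)
    (by simp) z
  refine (((hasDerivAt_layerCos l z).pow 2).sub
    (((hasDerivAt_layerSin l z).pow 2).const_mul l)).congr_deriv ?_
  push_cast
  ring

theorem layerCos_pos {l : ℝ} (hl : 0 ≤ l) (z : ℝ) : 0 < layerCos l z := by
  rw [layerCos_of_nonneg hl]
  exact Real.cosh_pos _

theorem layerSin_pos {l z : ℝ} (hl : 0 ≤ l) (hz : 0 < z) : 0 < layerSin l z :=
  intervalIntegral.intervalIntegral_pos_of_pos_on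
    ((continuous_layerCos_right l).intervalIntegrable _ _) (fun t _ => layerCos_pos hl t) hz

/-- Evenness of `cosh`: the choice of the square root `ν` of `l` is irrelevant. -/
theorem Complex.cosh_mul_eq_layerCos {ν : ℂ} {l : ℝ} (h : ν ^ 2 = l) (z : ℝ) :
    Complex.cosh (ν * z) = layerCos l z := by
  rcases le_total 0 l with hl | hl
  · have hs : ν ^ 2 = ((√l : ℝ) : ℂ) ^ 2 := by
      rw [h, ← Complex.ofReal_pow, Real.sq_sqrt hl]
    rw [layerCos_of_nonneg hl]
    rcases sq_eq_sq_iff_eq_or_eq_neg.1 hs with e | e <;> rw [e] <;> simp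
  · have hs : ν ^ 2 = (((√(-l) : ℝ) : ℂ) * Complex.I) ^ 2 := by
      rw [h, mul_pow, ← Complex.ofReal_pow, Real.sq_sqrt (neg_nonneg.2 hl)]; simp
    rw [layerCos_of_nonpos hl]
    rcases sq_eq_sq_iff_eq_or_eq_neg.1 hs with e | e <;> rw [e]
    · rw [mul_right_comm, Complex.cosh_mul_I]; simp
    · rw [neg_mul, Complex.cosh_neg, mul_right_comm, Complex.cosh_mul_I]; simp

theorem Complex.sinh_mul_eq_layerSin {ν : ℂ} {l : ℝ} (h : ν ^ 2 = l) (z : ℝ) :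
    Complex.sinh (ν * z) = ν * layerSin l z := by
  rcases le_total 0 l with hl | hl
  · have hs : ν ^ 2 = ((√l : ℝ) : ℂ) ^ 2 := by
      rw [h, ← Complex.ofReal_pow, Real.sq_sqrt hl]
    have key : Complex.sinh ((√l : ℝ) * z) = (√l : ℝ) * (layerSin l z : ℂ) := by
      rw [← Complex.ofReal_mul, ← Complex.ofReal_mul, sqrt_mul_layerSin_of_nonneg hl]; simp
    rcases sq_eq_sq_iff_eq_or_eq_neg.1 hs with e | e <;> rw [e]
    · exact key
    · rw [neg_mul, Complex.sinh_neg, key, neg_mul]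
  · have hs : ν ^ 2 = (((√(-l) : ℝ) : ℂ) * Complex.I) ^ 2 := by
      rw [h, mul_pow, ← Complex.ofReal_pow, Real.sq_sqrt (neg_nonneg.2 hl)]; simp
    have key : Complex.sinh ((√(-l) : ℝ) * Complex.I * z) =
        (√(-l) : ℝ) * Complex.I * (layerSin l z : ℂ) := by
      rw [mul_right_comm, Complex.sinh_mul_I, mul_right_comm, ← Complex.ofReal_mul,
        ← Complex.ofReal_mul, sqrt_mul_layerSin_of_nonpos hl]; simp
    rcases sq_eq_sq_iff_eq_or_eq_neg.1 hs with e | e <;> rw [e]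
    · exact key
    · rw [neg_mul, Complex.sinh_neg, key, neg_mul]

/-! ### Displacement and traction across one layer -/

/-- The displacement at depth `z` inside a layer of shear modulus `μ`, with vertical wavenumber
squared `l`, for the displacement `p` and the traction `q` at the top of the layer. -/
noncomputable def layerP (μ l p q z : ℝ) : ℝ := layerCos l z * p + layerSin l z / μ * q

/-- The traction at depth `z` inside a layer, in the setting of `layerP`. -/
noncomputable def layerQ (μ l p q z : ℝ) : ℝ := μ * l * layerSin l z * p + layerCos l z * q

@[simp] theorem layerP_zero (μ l p q : ℝ) : layerP μ l p q 0 = p := by simp [layerP]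

@[simp] theorem layerQ_zero (μ l p q : ℝ) : layerQ μ l p q 0 = q := by simp [layerQ]

theorem hasDerivAt_layerP {μ : ℝ} (hμ : μ ≠ 0) (l p q z : ℝ) :
    HasDerivAt (layerP μ l p q) (layerQ μ l p q z / μ) z := by
  refine (((hasDerivAt_layerCos l z).mul_const p).add
    (((hasDerivAt_layerSin l z).div_const μ).mul_const q)).congr_deriv ?_
  simp only [layerQ]
  field_simp

theorem hasDerivAt_layerQ {μ : ℝ} (hμ : μ ≠ 0) (l p q z : ℝ) :
    HasDerivAt (layerQ μ l p q) (μ * l * layerP μ l p q z) z := by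
  refine ((((hasDerivAt_layerSin l z).const_mul (μ * l)).mul_const p).add
    ((hasDerivAt_layerCos l z).mul_const q)).congr_deriv ?_
  simp only [layerP]
  field_simp

theorem continuous_layerP_right {μ : ℝ} (hμ : μ ≠ 0) (l p q : ℝ) :
    Continuous (layerP μ l p q) :=
  continuous_iff_continuousAt.2 fun z => (hasDerivAt_layerP hμ l p q z).continuousAt

theorem Continuous.layerP {X : Type*} [TopologicalSpace X] (μ : ℝ) {l p q z : X → ℝ}
    (hl : Continuous l) (hp : Continuous p) (hq : Continuous q) (hz : Continuous z) :
    Continuous fun x => layerP μ (l x) (p x) (q x) (z x) := by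
  unfold _root_.layerP
  exact ((continuous_layerCos.comp (hl.prodMk hz)).mul hp).add
    (((continuous_layerSin.comp (hl.prodMk hz)).div_const μ).mul hq)

theorem Continuous.layerQ {X : Type*} [TopologicalSpace X] (μ : ℝ) {l p q z : X → ℝ}
    (hl : Continuous l) (hp : Continuous p) (hq : Continuous q) (hz : Continuous z) :
    Continuous fun x => layerQ μ (l x) (p x) (q x) (z x) := by
  unfold _root_.layerQ
  exact (((continuous_const.mul hl).mul (continuous_layerSin.comp (hl.prodMk hz))).mul hp).add
    ((continuous_layerCos.comp (hl.prodMk hz)).mul hq)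

/-- The transfer through a layer is injective. -/
theorem eq_zero_of_layerP_eq_zero {μ : ℝ} (hμ : μ ≠ 0) {l p q z : ℝ}
    (hP : layerP μ l p q z = 0) (hQ : layerQ μ l p q z = 0) : p = 0 ∧ q = 0 := by
  have h := layerCos_sq_sub l z
  unfold layerP at hP
  unfold layerQ at hQ
  constructor
  · have e : (layerCos l z ^ 2 - l * layerSin l z ^ 2) * p = 0 := by
      have : (layerCos l z ^ 2 - l * layerSin l z ^ 2) * p =
          layerCos l z * (layerCos l z * p + layerSin l z / μ * q) - layerSin l z / μ *
            (μ * l * layerSin l z * p + layerCos l z * q) := by field_simp; ring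
      rw [this, hP, hQ]; ring
    simpa [h] using e
  · have e : (layerCos l z ^ 2 - l * layerSin l z ^ 2) * q = 0 := by
      have : (layerCos l z ^ 2 - l * layerSin l z ^ 2) * q =
          layerCos l z * (μ * l * layerSin l z * p + layerCos l z * q) - μ * l * layerSin l z *
            (layerCos l z * p + layerSin l z / μ * q) := by field_simp; ring
      rw [this, hP, hQ]; ring
    simpa [h] using e

/-- Evolution through a layer of the Wronskian of two solutions with different parameters. -/
theorem layer_wronskian {μ : ℝ} (hμ : μ ≠ 0) (l l' p q p' q' T : ℝ) :
    layerP μ l p q T * layerQ μ l' p' q' T - layerQ μ l p q T * layerP μ l' p' q' T =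
      p * q' - q * p' +
        (l' - l) * (μ * ∫ z in (0 : ℝ)..T, layerP μ l p q z * layerP μ l' p' q' z) := by
  have h := intervalIntegral.integral_eq_sub_of_hasDerivAt (a := 0) (b := T)
    (f := fun z => layerP μ l p q z * layerQ μ l' p' q' z - layerQ μ l p q z * layerP μ l' p' q' z)
    (f' := fun z => (l' - l) * μ * (layerP μ l p q z * layerP μ l' p' q' z))
    (fun z _ => by
      refine (((hasDerivAt_layerP hμ l p q z).mul (hasDerivAt_layerQ hμ l' p' q' z)).sub
        ((hasDerivAt_layerQ hμ l p q z).mul (hasDerivAt_layerP hμ l' p' q' z))).congr_deriv ?_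
      ring)
    ((((continuous_layerP_right hμ l p q).mul
      (continuous_layerP_right hμ l' p' q')).const_mul _).intervalIntegrable _ _)
  rw [intervalIntegral.integral_const_mul] at h
  simp only [layerP_zero, layerQ_zero] at h
  linarith

/-- The displacement is nonzero at the top, and the integrand is continuous and nonnegative. This
makes Sturm monotonicity available from the first layer on. -/
theorem integral_layerP_sq_pos {μ : ℝ} (hμ : μ ≠ 0) (l : ℝ) {p T : ℝ} (q : ℝ) (hp : p ≠ 0)
    (hT : 0 < T) : 0 < ∫ z in (0 : ℝ)..T, layerP μ l p q z * layerP μ l p q z := by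
  have hc := continuous_layerP_right hμ l p q
  refine intervalIntegral.integral_pos hT (hc.mul hc).continuousOn
    (fun x _ => mul_self_nonneg _) ⟨0, ⟨le_rfl, hT.le⟩, ?_⟩
  simpa using mul_self_pos.2 hp

/-! ### The Prüfer angle across one layer -/

open unitInterval in
/-- A continuous logarithm of the pair (displacement, traction) at the top of a layer, depending on
a parameter, extends to a continuous logarithm throughout the layer. -/
theorem exists_layer_log {μ : ℝ} (hμ : μ ≠ 0) (T : ℝ) {l : ℝ → ℝ} (hl : Continuous l) {L : ℝ → ℂ}
    (hL : Continuous L) :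
    ∃ Λ : I × ℝ → ℂ, Continuous Λ ∧ (∀ k, Λ (0, k) = L k) ∧
      ∀ (t : I) (k : ℝ),
        (Complex.exp (Λ (t, k))).re =
          layerP μ (l k) (Complex.exp (L k)).re (Complex.exp (L k)).im (t * T) ∧
        (Complex.exp (Λ (t, k))).im =
          layerQ μ (l k) (Complex.exp (L k)).re (Complex.exp (L k)).im (t * T) := by
  let P : I × ℝ → ℝ := fun x =>
    layerP μ (l x.2) (Complex.exp (L x.2)).re (Complex.exp (L x.2)).im (x.1 * T)
  let Q : I × ℝ → ℝ := fun x =>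
    layerQ μ (l x.2) (Complex.exp (L x.2)).re (Complex.exp (L x.2)).im (x.1 * T)
  have hE : Continuous fun x : I × ℝ => Complex.exp (L x.2) := by fun_prop
  have hP : Continuous P :=
    Continuous.layerP μ (hl.comp continuous_snd) (Complex.continuous_re.comp hE)
      (Complex.continuous_im.comp hE) (by fun_prop)
  have hQ : Continuous Q :=
    Continuous.layerQ μ (hl.comp continuous_snd) (Complex.continuous_re.comp hE)
      (Complex.continuous_im.comp hE) (by fun_prop)
  have hne : ∀ x, (P x : ℂ) + Q x * Complex.I ≠ 0 := fun x h0 => by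
    have h1 : P x = 0 := by simpa using congrArg Complex.re h0
    have h2 : Q x = 0 := by simpa using congrArg Complex.im h0
    obtain ⟨h3, h4⟩ := eq_zero_of_layerP_eq_zero hμ h1 h2
    exact Complex.exp_ne_zero (L x.2) (Complex.ext h3 h4)
  -- The scaled depth is the homotopy parameter and `L` is the initial lift; homotopy lifting along
  -- the covering `exp : ℂ → ℂ \ {0}` gives continuity jointly in depth and `k`.
  let H : C(I × ℝ, {z : ℂ // z ≠ 0}) :=
    ⟨fun x => ⟨(P x : ℂ) + Q x * Complex.I, hne x⟩,
      Continuous.subtype_mk (by fun_prop) _⟩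
  have H0 : ∀ a, H (0, a) = ⟨_, Complex.exp_ne_zero ((⟨L, hL⟩ : C(ℝ, ℂ)) a)⟩ := fun a => by
    apply Subtype.ext
    apply Complex.ext <;> simp [H, P, Q]
  refine ⟨Complex.isCoveringMap_exp.liftHomotopy H ⟨L, hL⟩ H0, ContinuousMap.continuous _,
    fun k => Complex.isCoveringMap_exp.liftHomotopy_zero H ⟨L, hL⟩ H0 k, fun t k => ?_⟩
  have h := congrArg Subtype.val
    (congrFun (Complex.isCoveringMap_exp.liftHomotopy_lifts H ⟨L, hL⟩ H0) (t, k))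
  simp only [Function.comp_apply] at h
  rw [h]
  constructor <;> simp [H, P, Q]

theorem cos_odd_mul_pi_div_two (m : ℤ) : Real.cos (Real.pi / 2 + m * Real.pi) = 0 := by
  rw [Real.cos_add_int_mul_pi, Real.cos_pi_div_two, mul_zero]

/-- A continuous function whose cosine does not vanish varies by less than `π`. -/
theorem abs_sub_lt_pi_of_cos_ne_zero {X : Type*} [TopologicalSpace X] [PreconnectedSpace X]
    {g : X → ℝ} (hg : Continuous g) (h : ∀ x, Real.cos (g x) ≠ 0) (x y : X) :
    |g x - g y| < Real.pi := by
  wlog hxy : g x ≤ g y generalizing x y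
  · rw [abs_sub_comm]; exact this y x (le_of_not_ge hxy)
  rw [abs_sub_comm, abs_of_nonneg (sub_nonneg.2 hxy)]
  by_contra! hlt
  have hpi := Real.pi_pos
  -- `π/2 + mπ` is the first zero of the cosine at or after `g x`; it lies less than `π` beyond `g
  -- x`, hence below `g y`.
  set m : ℤ := ⌈(g x - Real.pi / 2) / Real.pi⌉
  have h1 : g x ≤ Real.pi / 2 + m * Real.pi := by
    have := Int.le_ceil ((g x - Real.pi / 2) / Real.pi)
    rw [div_le_iff₀ hpi] at this
    linarith
  have h2 : Real.pi / 2 + m * Real.pi ≤ g y := by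
    have := Int.ceil_lt_add_one ((g x - Real.pi / 2) / Real.pi)
    rw [← sub_lt_iff_lt_add, lt_div_iff₀ hpi] at this
    linarith
  obtain ⟨z, hz⟩ := mem_range_of_exists_le_of_exists_ge hg ⟨x, h1⟩ ⟨y, h2⟩
  exact h z (hz ▸ cos_odd_mul_pi_div_two m)

open unitInterval in
/-- In an evanescent layer the Prüfer angle varies by at most `π`. -/
theorem layer_angle_of_nonneg {μ l T p q : ℝ} (hl : 0 ≤ l) (hT : 0 < T) {Λ : I → ℂ}
    (hΛ : Continuous Λ)
    (hP : ∀ t : I, (Complex.exp (Λ t)).re = layerP μ l p q (t * T))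
    (hQ : ∀ t : I, (Complex.exp (Λ t)).im = layerQ μ l p q (t * T)) :
    |(Λ 1).im - (Λ 0).im| ≤ Real.pi := by
  have hpi := Real.pi_pos
  set K : ℝ := μ * l * p ^ 2 - q ^ 2 / μ
  -- The cross product of the vectors at the top and at depth `z` is `layerSin l z` times the
  -- constant `K`. If the turn reached `π` at some positive depth, `K` would vanish, and then the
  -- sine would vanish everywhere, contradicting a turn of `π/2` on the way.
  have key : ∀ t : I, Real.exp (Λ 0).re * Real.exp (Λ t).re * Real.sin ((Λ t).im - (Λ 0).im) =
      layerSin l (t * T) * K := fun t => by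
    have hP0 := hP 0
    have hQ0 := hQ 0
    have hPt := hP t
    have hQt := hQ t
    simp only [Set.Icc.coe_zero, zero_mul, layerP_zero, layerQ_zero, Complex.exp_re,
      Complex.exp_im] at hP0 hQ0 hPt hQt
    have e : p * layerQ μ l p q (t * T) - q * layerP μ l p q (t * T) =
        layerSin l (t * T) * K := by
      simp only [layerQ, layerP, K]; ring
    rw [← e, ← hPt, ← hQt, Real.sin_sub, ← hP0, ← hQ0]
    ring
  by_contra! hlt
  obtain ⟨ε, hε, hge⟩ : ∃ ε : ℝ, (ε = 1 ∨ ε = -1) ∧ Real.pi < ε * ((Λ 1).im - (Λ 0).im) := by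
    rcases lt_abs.1 hlt with h | h
    · exact ⟨1, Or.inl rfl, by linarith⟩
    · exact ⟨-1, Or.inr rfl, by linarith⟩
  have hc : Continuous fun t : I => ε * ((Λ t).im - (Λ 0).im) := by fun_prop
  have hsin : ∀ t : I, Real.sin (ε * ((Λ t).im - (Λ 0).im)) =
      ε * Real.sin ((Λ t).im - (Λ 0).im) := fun t => by
    rcases hε with rfl | rfl
    · rw [one_mul, one_mul]
    · rw [neg_one_mul, neg_one_mul, Real.sin_neg]
  obtain ⟨t, ht⟩ := mem_range_of_exists_le_of_exists_ge hc (c := Real.pi)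
    ⟨0, by simpa using hpi.le⟩ ⟨1, hge.le⟩
  obtain ⟨s, hs⟩ := mem_range_of_exists_le_of_exists_ge hc (c := Real.pi / 2)
    ⟨0, by rw [sub_self, mul_zero]; linarith⟩ ⟨1, by linarith⟩
  simp only at ht hs
  have ht1 : Real.sin ((Λ t).im - (Λ 0).im) = 0 := by
    have := hsin t
    rw [ht, Real.sin_pi] at this
    rcases hε with rfl | rfl <;> linarith
  have hs1 : Real.sin ((Λ s).im - (Λ 0).im) ≠ 0 := fun h => by
    have := hsin s
    rw [hs, h, Real.sin_pi_div_two] at this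
    simp at this
  have ht0 : 0 < (t : ℝ) := by
    refine lt_of_le_of_ne t.2.1 fun h => ?_
    have : t = 0 := Subtype.ext h.symm
    rw [this] at ht
    simp at ht
    exact hpi.ne ht
  have hK : K = 0 := by
    have := key t
    rw [ht1, mul_zero] at this
    exact (mul_eq_zero.1 this.symm).resolve_left (layerSin_pos hl (mul_pos ht0 hT)).ne'
  have := key s
  rw [hK, mul_zero] at this
  exact hs1 ((mul_eq_zero.1 this).resolve_left (by positivity))

open unitInterval in
/-- In an oscillating layer the Prüfer angle rotates at the constant rate `√(-l)`, up to an error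
of at most `π`. -/
theorem layer_angle_of_neg {μ l T p q : ℝ} (hμ : 0 < μ) (hl : l < 0) {Λ : I → ℂ}
    (hΛ : Continuous Λ)
    (hP : ∀ t : I, (Complex.exp (Λ t)).re = layerP μ l p q (t * T))
    (hQ : ∀ t : I, (Complex.exp (Λ t)).im = layerQ μ l p q (t * T)) :
    |(Λ 1).im - (Λ 0).im + √(-l) * T| ≤ Real.pi := by
  set w : ℝ := √(-l)
  have hw : 0 < w := Real.sqrt_pos.2 (neg_pos.2 hl)
  have hw2 : w * w = -l := Real.mul_self_sqrt (neg_pos.2 hl).le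
  -- In the rescaled coordinates `(P, Q/(μw))` the flow is a rigid clockwise rotation at rate `w`.
  set v : ℂ := ⟨p, q / (μ * w)⟩
  have hv : v ≠ 0 := fun h => by
    have h1 : p = 0 := congrArg Complex.re h
    have h2 : q / (μ * w) = 0 := congrArg Complex.im h
    have h3 : q = 0 := by
      rcases div_eq_zero_iff.1 h2 with h | h
      · exact h
      · exact absurd h (by positivity)
    refine Complex.exp_ne_zero (Λ 0) (Complex.ext ?_ ?_)
    · rw [hP 0]; simp [h1]
    · rw [hQ 0]; simp [h3]
  have hvre : p = ‖v‖ * Real.cos v.arg := (Complex.norm_mul_cos_arg v).symm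
  have hvim : q = μ * w * (‖v‖ * Real.sin v.arg) := by
    rw [Complex.norm_mul_sin_arg v]; simp only [v]; field_simp
  have hS : ∀ z, w * layerSin l z = Real.sin (w * z) := sqrt_mul_layerSin_of_nonpos hl.le
  have hCo : ∀ z, layerCos l z = Real.cos (w * z) := layerCos_of_nonpos hl.le
  have hvpos : 0 < ‖v‖ := norm_pos_iff.2 hv
  have hP' : ∀ z, layerP μ l p q z = ‖v‖ * Real.cos (v.arg - w * z) := fun z => by
    rw [layerP, Real.cos_sub, hCo, ← hS]
    have : layerSin l z / μ * q = w * layerSin l z * (‖v‖ * Real.sin v.arg) := by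
      nth_rewrite 1 [hvim]; field_simp
    rw [this]
    nth_rewrite 1 [hvre]
    ring
  have hQ' : ∀ z, layerQ μ l p q z = μ * w * (‖v‖ * Real.sin (v.arg - w * z)) := fun z => by
    rw [layerQ, Real.sin_sub, hCo, ← hS]
    have hl' : l = -(w * w) := by linarith
    have : μ * l * layerSin l z * p = -(μ * w * (w * layerSin l z) * (‖v‖ * Real.cos v.arg)) := by
      rw [← hvre]
      nth_rewrite 1 [hl']
      ring
    rw [this]
    linear_combination Real.cos (w * z) * hvim
  -- A vector and its image under a positive diagonal scaling have positive inner product, so the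
  -- true and the rescaled angles never differ by an odd multiple of `π/2`.
  have hcos : ∀ t : I, Real.cos ((Λ t).im - (v.arg - w * (t * T))) ≠ 0 := fun t => by
    have h1 := hP t
    have h2 := hQ t
    rw [hP', Complex.exp_re] at h1
    rw [hQ', Complex.exp_im] at h2
    set α := v.arg - w * (t * T)
    set θ := (Λ t).im
    have hr := Real.exp_pos (Λ t).re
    have e : Real.exp (Λ t).re * ‖v‖ * Real.cos (θ - α) =
        (‖v‖ * Real.cos α) ^ 2 + μ * w * (‖v‖ * Real.sin α) ^ 2 := by
      rw [Real.cos_sub]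
      linear_combination ‖v‖ * Real.cos α * h1 + ‖v‖ * Real.sin α * h2
    intro h0
    rw [h0, mul_zero] at e
    have hcs := Real.sin_sq_add_cos_sq α
    have ha : 0 ≤ (‖v‖ * Real.cos α) ^ 2 := sq_nonneg _
    have hb : 0 ≤ μ * w * (‖v‖ * Real.sin α) ^ 2 := by positivity
    have ha0 : (‖v‖ * Real.cos α) ^ 2 = 0 := by linarith
    have hb0 : μ * w * (‖v‖ * Real.sin α) ^ 2 = 0 := by linarith
    have ha1 : Real.cos α = 0 := by
      simpa [hvpos.ne'] using ha0
    have hb1 : Real.sin α = 0 := by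
      simpa [hvpos.ne', hμ.ne', hw.ne'] using hb0
    rw [ha1, hb1] at hcs
    norm_num at hcs
  have hg : Continuous fun t : I => (Λ t).im - (v.arg - w * (t * T)) := by fun_prop
  have := abs_sub_lt_pi_of_cos_ne_zero hg hcos 1 0
  simp only [Set.Icc.coe_one, Set.Icc.coe_zero, one_mul, zero_mul, mul_zero] at this
  have e : (Λ 1).im - (Λ 0).im + w * T = (Λ 1).im - (v.arg - w * T) - ((Λ 0).im - (v.arg - 0)) := by
    ring
  rw [e]
  exact this.le

open unitInterval in
/-- An evanescent layer preserves the sector of nonnegative impedance. -/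
theorem layer_angle_mem_Ico {μ l T p q : ℝ} (hμ : 0 < μ) (hl : 0 ≤ l) (hT : 0 < T) {Λ : I → ℂ}
    (hΛ : Continuous Λ)
    (hP : ∀ t : I, (Complex.exp (Λ t)).re = layerP μ l p q (t * T))
    (hQ : ∀ t : I, (Complex.exp (Λ t)).im = layerQ μ l p q (t * T))
    (h0 : (Λ 0).im ∈ Set.Ico 0 (Real.pi / 2)) : (Λ 1).im ∈ Set.Ico 0 (Real.pi / 2) := by
  have hpi := Real.pi_pos
  have hb := abs_le.1 (layer_angle_of_nonneg hl hT hΛ hP hQ)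
  have hp : 0 < p := by
    have := hP 0
    simp only [Set.Icc.coe_zero, zero_mul, layerP_zero, Complex.exp_re] at this
    rw [← this]
    exact mul_pos (Real.exp_pos _) (Real.cos_pos_of_mem_Ioo ⟨by linarith [h0.1], h0.2⟩)
  have hq : 0 ≤ q := by
    have := hQ 0
    simp only [Set.Icc.coe_zero, zero_mul, layerQ_zero, Complex.exp_im] at this
    rw [← this]
    exact mul_nonneg (Real.exp_pos _).le
      (Real.sin_nonneg_of_nonneg_of_le_pi h0.1 (by linarith [h0.2]))
  have hS := layerSin_pos hl hT
  have hC := layerCos_pos hl T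
  have hcos : 0 < Real.cos (Λ 1).im := by
    have := hP 1
    rw [Set.Icc.coe_one, one_mul, Complex.exp_re] at this
    have h : 0 < layerP μ l p q T := by unfold layerP; positivity
    rw [← this] at h
    exact pos_of_mul_pos_right h (Real.exp_pos _).le
  have hsin : 0 ≤ Real.sin (Λ 1).im := by
    have := hQ 1
    rw [Set.Icc.coe_one, one_mul, Complex.exp_im] at this
    have h : 0 ≤ layerQ μ l p q T := by unfold layerQ; positivity
    rw [← this] at h
    exact nonneg_of_mul_nonneg_right h (Real.exp_pos _)
  -- The signs of cosine and sine fix the quadrant only modulo `2π`; the bound `π` on the turn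
  -- selects the branch.
  have hlt : (Λ 1).im < Real.pi / 2 := by
    by_contra! h
    exact absurd hcos (not_lt.2 (Real.cos_nonpos_of_pi_div_two_le_of_le h
      (by linarith [h0.2, hb.2])))
  have hgt : -(Real.pi / 2) < (Λ 1).im := by
    by_contra! h
    have := Real.cos_nonpos_of_pi_div_two_le_of_le (x := -(Λ 1).im) (by linarith)
      (by linarith [h0.1, hb.1])
    rw [Real.cos_neg] at this
    linarith
  refine ⟨?_, hlt⟩
  by_contra! h
  exact absurd hsin (not_le.2 (Real.sin_neg_of_neg_of_neg_pi_lt h (by linarith)))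

open Filter Topology in
/-- A continuous function that does not decrease immediately to the right of any point of an
interval does not decrease over the interval. -/
theorem le_of_forall_eventually_nhdsGT_le {f : ℝ → ℝ} (hf : Continuous f) {a b : ℝ} (hab : a ≤ b)
    (h : ∀ x ∈ Set.Ico a b, ∀ᶠ y in 𝓝[>] x, f x ≤ f y) : f a ≤ f b := by
  have hs : IsClosed ({x | f a ≤ f x} ∩ Set.Icc a b) :=
    (isClosed_le continuous_const hf).inter isClosed_Icc
  have := hs.Icc_subset_of_forall_mem_nhdsWithin (a := a) (b := b) (le_refl (f a))
    (fun x hx => (h x hx.2).mono fun y hy => le_trans hx.1 hy)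
  exact this ⟨hab, le_rfl⟩

/-! ### Reduction of the medium to real transfer matrices -/

theorem lowerSqrt_of_nonneg {x : ℝ} (hx : 0 ≤ x) : lowerSqrt x = (√x : ℝ) := by
  simp [lowerSqrt, Real.sqrt_eq_zero_of_nonpos (neg_nonpos.2 hx)]

theorem lowerSqrt_of_nonpos {x : ℝ} (hx : x ≤ 0) : lowerSqrt x = -(Complex.I * (√(-x) : ℝ)) := by
  simp [lowerSqrt, Real.sqrt_eq_zero_of_nonpos hx]

theorem norm_lowerSqrt_of_nonpos {x : ℝ} (hx : x ≤ 0) : ‖lowerSqrt x‖ = √(-x) := by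
  rw [lowerSqrt_of_nonpos hx]
  simp [abs_of_nonneg (Real.sqrt_nonneg _)]

namespace LayeredMedium

variable {n : ℕ} (m : LayeredMedium n)

theorem C_pos (j : Fin (n + 1)) : 0 < m.C j :=
  Real.sqrt_pos.2 (div_pos (m.μ_pos j) (m.ρ_pos j))

theorem width_pos (i : Fin n) : 0 < m.width i :=
  sub_pos.2 (m.H_strictMono i.castSucc_lt_succ)

/-- The square of the vertical wavenumber `ν_j(ω, k)`, a real number. -/
noncomputable def νSq (j : Fin (n + 1)) (ω k : ℝ) : ℝ := k ^ 2 - ω ^ 2 / m.C j ^ 2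

theorem continuous_νSq (j : Fin (n + 1)) (ω : ℝ) : Continuous (m.νSq j ω) := by
  unfold νSq; fun_prop

theorem C_sq_mul_νSq (j : Fin (n + 1)) (ω k : ℝ) :
    m.C j ^ 2 * m.νSq j ω k = m.C j ^ 2 * k ^ 2 - ω ^ 2 := by
  have := (m.C_pos j).ne'
  unfold νSq; field_simp

theorem ν_eq_lowerSqrt (j : Fin (n + 1)) (ω k : ℝ) : m.ν j ω k = lowerSqrt (m.νSq j ω k) := by
  have hC := m.C_pos j
  have e : ∀ x, √(m.C j ^ 2 * x) = m.C j * √x := fun x => by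
    rw [Real.sqrt_mul (sq_nonneg _), Real.sqrt_sq hC.le]
  rw [ν, ← C_sq_mul_νSq, lowerSqrt, lowerSqrt, e, ← mul_neg, e]
  have : (m.C j : ℂ) ≠ 0 := by exact_mod_cast hC.ne'
  push_cast
  field_simp

theorem ν_sq (j : Fin (n + 1)) (ω k : ℝ) : m.ν j ω k ^ 2 = (m.νSq j ω k : ℝ) := by
  rw [ν_eq_lowerSqrt, lowerSqrt_sq]

theorem νSq_nonneg_iff (j : Fin (n + 1)) {ω k : ℝ} (hω : 0 ≤ ω) (hk : 0 ≤ k) :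
    0 ≤ m.νSq j ω k ↔ ω / m.C j ≤ k := by
  rw [νSq, sub_nonneg, ← div_pow, sq_le_sq₀ (div_nonneg hω (m.C_pos j).le) hk]

/-- The entries are even in `ν`, so they are real functions of `ν²`; the separate case `ν = 0` is
absorbed because `layerSin 0 z = z`. -/
theorem transfer_eq (i : Fin n) (ω k : ℝ) :
    m.transfer i ω k =
      !![(layerCos (m.νSq i.castSucc ω k) (m.width i) : ℂ),
          (layerSin (m.νSq i.castSucc ω k) (m.width i) / m.μ i.castSucc : ℂ);
        (m.μ i.castSucc * m.νSq i.castSucc ω k *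
          layerSin (m.νSq i.castSucc ω k) (m.width i) : ℂ),
          (layerCos (m.νSq i.castSucc ω k) (m.width i) : ℂ)] := by
  have hν := m.ν_sq i.castSucc ω k
  rw [transfer]
  split_ifs with h0
  · have hl : m.νSq i.castSucc ω k = 0 := by
      rw [h0] at hν
      simpa using hν.symm
    rw [hl, layerSin_zero_left]
    simp [layerCos]
  · have hμ : (m.μ i.castSucc : ℂ) ≠ 0 := by exact_mod_cast (m.μ_pos i.castSucc).ne'
    rw [Complex.cosh_mul_eq_layerCos hν, Complex.sinh_mul_eq_layerSin hν, ← hν]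
    congr! 3
    · field_simp
    · congr 1
      ring

theorem PQ_zero (ω k : ℝ) : m.PQ ω k 0 = ![1, 0] := by simp [PQ]

theorem PQ_succ (ω k : ℝ) (i : Fin n) {p q : ℝ} (h : m.PQ ω k i.castSucc = ![(p : ℂ), (q : ℂ)]) :
    m.PQ ω k i.succ =
      ![(layerP (m.μ i.castSucc) (m.νSq i.castSucc ω k) p q (m.width i) : ℂ),
        (layerQ (m.μ i.castSucc) (m.νSq i.castSucc ω k) p q (m.width i) : ℂ)] := by
  have e : m.PQ ω k i.succ = Matrix.mulVec (m.transfer i ω k) (m.PQ ω k i.castSucc) := by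
    simp only [PQ, Fin.induction_succ]
  rw [e, h, transfer_eq]
  ext x
  fin_cases x
  · simp [Matrix.mulVec, dotProduct, layerP]
  · simp [Matrix.mulVec, dotProduct, layerQ]

/-! ### The Prüfer angle of the whole stack -/

/-- `L` is a continuous logarithm of `P_j + i Q_j` as a function of the wavenumber, normalized at
the surface; the imaginary part of `L` is the Prüfer angle at the bottom of the `j`-th layer. -/
structure IsPruferLog (ω : ℝ) (j : Fin (n + 1)) (L : ℝ → ℂ) : Prop where
  continuous : Continuous L
  eq : ∀ k, m.PQ ω k j = ![((Complex.exp (L k)).re : ℂ), ((Complex.exp (L k)).im : ℂ)]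
  rotation : ∀ k, |(L k).im + ∑ i : Fin n with i.castSucc < j,
    √(-m.νSq i.castSucc ω k) * m.width i| ≤ (j : ℕ) * Real.pi
  sector : ∀ k, (∀ i : Fin n, 0 ≤ m.νSq i.castSucc ω k) → (L k).im ∈ Set.Ico 0 (Real.pi / 2)
  -- `J k k'` stands for the integral of `μ` times the product of the displacements at `k` and `k'`
  -- over the layers crossed. On the diagonal it may vanish only at the surface, where the nonzero
  -- displacement starts the induction.
  wronskian : ∃ J : ℝ → ℝ → ℝ, (∀ k, Continuous (J k)) ∧
    (∀ k k', (Complex.exp (L k)).re * (Complex.exp (L k')).im -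
      (Complex.exp (L k)).im * (Complex.exp (L k')).re = (k' ^ 2 - k ^ 2) * J k k') ∧
    ∀ k, 0 ≤ J k k ∧ (J k k = 0 → j = 0 ∧ (Complex.exp (L k)).re ≠ 0)

theorem isPruferLog_zero (ω : ℝ) : m.IsPruferLog ω 0 fun _ => 0 where
  continuous := continuous_const
  eq k := by simp [PQ_zero]
  rotation k := by simp
  sector k _ := by simp [Real.pi_pos]
  wronskian := ⟨fun _ _ => 0, fun _ => continuous_const, by simp, by simp⟩

theorem IsPruferLog.exists_succ {ω : ℝ} {i : Fin n} {L : ℝ → ℂ}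
    (h : m.IsPruferLog ω i.castSucc L) : ∃ L', m.IsPruferLog ω i.succ L' := by
  have hμ := m.μ_pos i.castSucc
  have hT := m.width_pos i
  obtain ⟨Λ, hΛ, hΛ0, hΛe⟩ :=
    exists_layer_log hμ.ne' (m.width i) (m.continuous_νSq i.castSucc ω) h.continuous
  have hP := fun t k => (hΛe t k).1
  have hQ := fun t k => (hΛe t k).2
  have hΛk : ∀ k, Continuous fun t => Λ (t, k) := fun k => by fun_prop
  refine ⟨fun k => Λ (1, k), ?_, fun k => ?_, fun k => ?_, fun k hk => ?_, ?_⟩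
  · fun_prop
  · rw [m.PQ_succ ω k i (h.eq k), hP, hQ, Set.Icc.coe_one, one_mul]
  · have hfilter : (Finset.univ.filter fun i' : Fin n => i'.castSucc < i.succ) =
        insert i (Finset.univ.filter fun i' : Fin n => i'.castSucc < i.castSucc) := by
      ext x
      simp [Fin.castSucc_lt_succ_iff, le_iff_eq_or_lt]
    rw [hfilter, Finset.sum_insert (by simp)]
    have h1 : |(Λ (1, k)).im - (L k).im + √(-m.νSq i.castSucc ω k) * m.width i| ≤ Real.pi := by
      rw [← hΛ0 k]
      rcases le_or_gt 0 (m.νSq i.castSucc ω k) with hl | hl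
      · rw [Real.sqrt_eq_zero_of_nonpos (neg_nonpos.2 hl), zero_mul, add_zero]
        exact layer_angle_of_nonneg hl hT (hΛk k) (hP · k) (hQ · k)
      · exact layer_angle_of_neg hμ hl (hΛk k) (hP · k) (hQ · k)
    have h2 := h.rotation k
    have h3 := abs_add_le _ _ |>.trans (add_le_add h1 h2)
    refine (le_of_eq ?_).trans (h3.trans (le_of_eq ?_))
    · congr 1; ring
    · simp; ring
  · refine layer_angle_mem_Ico hμ (hk i) hT (hΛk k) (hP · k) (hQ · k) ?_
    rw [hΛ0]
    exact h.sector k hk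
  · obtain ⟨J, hJc, hJ, hJ0⟩ := h.wronskian
    set p : ℝ → ℝ := fun k => (Complex.exp (L k)).re
    set q : ℝ → ℝ := fun k => (Complex.exp (L k)).im
    have hL := h.continuous
    have hp : Continuous p := by fun_prop
    have hq : Continuous q := by fun_prop
    let P : ℝ → ℝ → ℝ := fun k z => layerP (m.μ i.castSucc) (m.νSq i.castSucc ω k) (p k) (q k) z
    -- `layer_wronskian` adds this layer's integral: the difference of the two values of `νSq` is
    -- `k'² - k²` in every layer, so the factor is common.
    refine ⟨fun k k' => J k k' + m.μ i.castSucc * ∫ z in (0 : ℝ)..m.width i, P k z * P k' z,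
      fun k => ?_, fun k k' => ?_, fun k => ?_⟩
    · refine (hJc k).add (continuous_const.mul ?_)
      refine intervalIntegral.continuous_parametric_intervalIntegral_of_continuous' ?_ _ _
      refine ((continuous_layerP_right hμ.ne' _ _ _).comp continuous_snd).mul ?_
      exact Continuous.layerP _ ((m.continuous_νSq _ ω).comp continuous_fst)
        (hp.comp continuous_fst) (hq.comp continuous_fst) continuous_snd
    · simp only [hP, hQ, Set.Icc.coe_one, one_mul]
      rw [layer_wronskian hμ.ne', hJ]
      simp only [νSq, P, p, q]
      ring
    · have hint : 0 ≤ ∫ z in (0 : ℝ)..m.width i, P k z * P k z :=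
        intervalIntegral.integral_nonneg hT.le fun z _ => mul_self_nonneg _
      have hpos : 0 < J k k + m.μ i.castSucc * ∫ z in (0 : ℝ)..m.width i, P k z * P k z := by
        rcases (hJ0 k).1.lt_or_eq with hlt | heq
        · positivity
        · have := integral_layerP_sq_pos hμ.ne' (m.νSq i.castSucc ω k) (q k)
            ((hJ0 k).2 heq.symm).2 hT
          rw [← heq, zero_add]
          exact mul_pos hμ this
      exact ⟨hpos.le, fun h => absurd h hpos.ne'⟩

theorem exists_isPruferLog (ω : ℝ) (j : Fin (n + 1)) : ∃ L, m.IsPruferLog ω j L := by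
  induction j using Fin.induction with
  | zero => exact ⟨_, m.isPruferLog_zero ω⟩
  | succ i ih =>
    obtain ⟨L, hL⟩ := ih
    exact hL.exists_succ

open Filter Topology in
/-- Sturm monotonicity: the Prüfer angle increases with the wavenumber. -/
theorem IsPruferLog.im_monotoneOn {ω : ℝ} {j : Fin (n + 1)} {L : ℝ → ℂ} (h : m.IsPruferLog ω j L)
    (hj : j ≠ 0) : MonotoneOn (fun k => (L k).im) (Set.Ioi 0) := by
  obtain ⟨J, hJc, hJ, hJ0⟩ := h.wronskian
  have hL := h.continuous
  have hc : Continuous fun k => (L k).im := by fun_prop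
  intro a ha b _ hab
  refine le_of_forall_eventually_nhdsGT_le hc hab fun x hx => ?_
  have hx0 : 0 < x := lt_of_lt_of_le ha hx.1
  have hJx : 0 < J x x := lt_of_le_of_ne (hJ0 x).1 fun e => hj ((hJ0 x).2 e.symm).1
  have e1 : ∀ᶠ y in 𝓝[>] x, 0 < J x y :=
    ((hJc x).tendsto x).eventually_const_lt hJx |>.filter_mono nhdsWithin_le_nhds
  -- Continuity keeps a possible decrease below `π`, so the sign of the Wronskian, which is a sine
  -- of the angle difference, decides the order of the angles.
  have e2 : ∀ᶠ y in 𝓝[>] x, (L x).im - Real.pi < (L y).im :=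
    (hc.tendsto x).eventually_const_lt (by linarith [Real.pi_pos])
      |>.filter_mono nhdsWithin_le_nhds
  filter_upwards [e1, e2, self_mem_nhdsWithin] with y h1 h2 hxy
  rw [Set.mem_Ioi] at hxy
  by_contra! hlt
  have h3 := hJ x y
  simp only [Complex.exp_re, Complex.exp_im] at h3
  have h4 : Real.exp (L x).re * Real.exp (L y).re * Real.sin ((L x).im - (L y).im) =
      -((y ^ 2 - x ^ 2) * J x y) := by
    rw [← h3, Real.sin_sub]; ring
  have h5 : 0 < Real.sin ((L x).im - (L y).im) :=
    Real.sin_pos_of_pos_of_lt_pi (by linarith) (by linarith)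
  have h6 : 0 < (y ^ 2 - x ^ 2) * J x y :=
    mul_pos (by nlinarith) h1
  have h7 : 0 < Real.exp (L x).re * Real.exp (L y).re * Real.sin ((L x).im - (L y).im) := by
    positivity
  linarith

end LayeredMedium

/-! ### From the phase to the counting function -/

/-- Counting the points where a strictly increasing phase is a multiple of `π`. -/
theorem finite_and_abs_ncard_sin_eq_zero_add_le {Φ : ℝ → ℝ} (hΦ : Continuous Φ) {a b : ℝ}
    (hab : a ≤ b) (hmono : StrictMonoOn Φ (Set.Ici a))
    (hb : ∀ k, b ≤ k → Φ k ∈ Set.Ioo 0 Real.pi) :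
    {k | Real.sin (Φ k) = 0 ∧ a ≤ k}.Finite ∧
      |({k | Real.sin (Φ k) = 0 ∧ a ≤ k}.ncard : ℝ) + Φ a / Real.pi| ≤ 1 := by
  have hpi := Real.pi_pos
  set S := {k | Real.sin (Φ k) = 0 ∧ a ≤ k}
  have hinj : Set.InjOn (fun k => Φ k / Real.pi) S := fun x hx y hy e => by
    have : Φ x = Φ y := by
      have e' : Φ x / Real.pi = Φ y / Real.pi := e
      field_simp at e'
      exact e'
    exact hmono.injOn hx.2 hy.2 this
  -- The multiples of `π` attained are exactly those with index from `c` to `0`: `Φ < π` excludes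
  -- index `1`, and `Φ b > 0` lets the intermediate value theorem reach the others.
  set c : ℤ := ⌈Φ a / Real.pi⌉
  have himg : (fun k => Φ k / Real.pi) '' S = Int.cast '' (Finset.Icc c 0 : Set ℤ) := by
    ext x
    constructor
    · rintro ⟨k, ⟨hk, hak⟩, rfl⟩
      obtain ⟨z, hz⟩ := Real.sin_eq_zero_iff.1 hk
      have hz' : Φ k / Real.pi = z := by rw [← hz]; field_simp
      refine ⟨z, ?_, hz'.symm⟩
      rw [Finset.coe_Icc, Set.mem_Icc]
      constructor
      · refine Int.ceil_le.2 ?_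
        rw [← hz']
        gcongr
        exact hmono.monotoneOn (Set.mem_Ici.2 le_rfl) hak hak
      · have h1 : Φ k < Real.pi := by
          rcases le_total k b with h | h
          · exact (hmono.monotoneOn hak (Set.mem_Ici.2 hab) h).trans_lt (hb b le_rfl).2
          · exact (hb k h).2
        have h2 : (z : ℝ) < 1 := by rw [← hz', div_lt_one hpi]; exact h1
        have : z < 1 := by exact_mod_cast h2
        omega
    · rintro ⟨z, hz, rfl⟩
      rw [Finset.coe_Icc, Set.mem_Icc] at hz
      have h1 : Φ a ≤ z * Real.pi := by
        have := Int.ceil_le.1 hz.1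
        rwa [div_le_iff₀ hpi] at this
      have h2 : z * Real.pi ≤ Φ b := by
        have : (z : ℝ) ≤ 0 := by exact_mod_cast hz.2
        nlinarith [(hb b le_rfl).1]
      obtain ⟨k, hk, hkz⟩ := intermediate_value_Icc hab hΦ.continuousOn ⟨h1, h2⟩
      refine ⟨k, ⟨?_, hk.1⟩, ?_⟩
      · rw [hkz, Real.sin_int_mul_pi]
      · simp only [hkz]; field_simp
  have hfin : S.Finite := by
    refine Set.Finite.of_finite_image ?_ hinj
    rw [himg]
    exact (Finset.finite_toSet _).image _
  refine ⟨hfin, ?_⟩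
  have hcard : S.ncard = (0 + 1 - c).toNat := by
    rw [← hinj.ncard_image, himg,
      Set.ncard_image_of_injective _ Int.cast_injective, Set.ncard_coe_finset, Int.card_Icc]
  -- This keeps `1 - c` nonnegative, so `toNat` truncates nothing.
  have hc1 : c ≤ 1 := by
    refine Int.ceil_le.2 ?_
    rw [Int.cast_one, div_le_one hpi]
    exact (hmono.monotoneOn (Set.mem_Ici.2 le_rfl) (Set.mem_Ici.2 hab) hab).trans
      (hb b le_rfl).2.le
  have hcast : (S.ncard : ℝ) = 1 - c := by
    have : ((S.ncard : ℕ) : ℤ) = 1 - c := by rw [hcard]; omega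
    exact_mod_cast this
  rw [hcast, abs_le]
  have h1 := Int.le_ceil (Φ a / Real.pi)
  have h2 := Int.ceil_lt_add_one (Φ a / Real.pi)
  constructor <;> linarith

namespace LayeredMedium

variable {n : ℕ} (m : LayeredMedium n)

/-- The counting function `N` counts the wavenumbers `k ≥ ω y` when there are finitely many. -/
theorem N_eq_ncard {ω y : ℝ} (hω : 0 < ω)
    (hfin : {k | k ∈ m.wavenumbers ω ∧ y * ω ≤ k}.Finite) :
    m.N ω y = {k | k ∈ m.wavenumbers ω ∧ y * ω ≤ k}.ncard := by
  set S := {k | k ∈ m.wavenumbers ω ∧ y * ω ≤ k}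
  let A : ℝ → Set ℝ := fun k => {k' ∈ m.wavenumbers ω | k < k'}
  have hAS : ∀ k ∈ S, A k ⊆ S := fun k hk k' hk' => ⟨hk'.1, hk.2.trans hk'.2.le⟩
  have hAfin : ∀ k ∈ S, (A k).Finite := fun k hk => hfin.subset (hAS k hk)
  have hAlt : ∀ k ∈ S, (A k).ncard < S.ncard := fun k hk =>
    Set.ncard_lt_ncard ⟨hAS k hk, fun h => lt_irrefl k (h hk).2⟩ hfin
  have hmono : ∀ k k', k' ∈ m.wavenumbers ω → k < k' → (A k).Finite →
      (A k').ncard < (A k).ncard := fun k k' hk' hlt hf =>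
    Set.ncard_lt_ncard ⟨fun x hx => ⟨hx.1, hlt.trans hx.2⟩,
      fun h => lt_irrefl k' (h ⟨hk', hlt⟩).2⟩ hf
  -- The number of larger solutions, once finite, strictly decreases along the solutions; at most
  -- one has rank `ℓ`, and the supremum is over a singleton.
  have hbranch : ∀ ℓ : ℕ, ∀ k ∈ m.wavenumbers ω, (A k).encard + 1 = (ℓ : ℕ∞) →
      m.branch ℓ ω = k := by
    intro ℓ k hk hkℓ
    have hset : {x : EReal | ∃ k ∈ m.wavenumbers ω,
        {k' ∈ m.wavenumbers ω | k < k'}.encard + 1 = (ℓ : ℕ∞) ∧ x = (k : EReal)} =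
        {(k : EReal)} := by
      have hnc : ∀ x, (A x).encard + 1 = (ℓ : ℕ∞) → (A x).Finite ∧ (A x).ncard + 1 = ℓ :=
        fun x hx => by
          have hf : (A x).Finite := by
            refine Set.encard_ne_top_iff.1 fun ht => ?_
            rw [ht, top_add] at hx
            exact ENat.top_ne_natCast _ hx
          refine ⟨hf, ?_⟩
          rw [← hf.cast_ncard_eq] at hx
          exact_mod_cast hx
      ext x
      constructor
      · rintro ⟨k', hk', hk'ℓ, rfl⟩
        obtain ⟨f1, c1⟩ := hnc k hkℓ
        obtain ⟨f2, c2⟩ := hnc k' hk'ℓ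
        rcases lt_trichotomy k k' with h | h | h
        · have := hmono k k' hk' h f1; omega
        · rw [h]; rfl
        · have := hmono k' k hk h f2; omega
      · rintro rfl
        exact ⟨k, hk, hkℓ, rfl⟩
    rw [branch, hset, sSup_singleton]
  have hdiv : ∀ x : EReal, (y : EReal) ≤ x / (ω : EReal) ↔ ((y * ω : ℝ) : EReal) ≤ x := fun x => by
    rw [EReal.le_div_iff_mul_le (by exact_mod_cast hω) (EReal.coe_ne_top _), EReal.coe_mul]
  have hset : {ℓ : ℕ | 1 ≤ ℓ ∧ (y : EReal) ≤ m.branch ℓ ω / (ω : EReal)} =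
      (fun k => (A k).ncard + 1) '' S := by
    ext ℓ
    constructor
    · rintro ⟨-, h⟩
      rw [hdiv] at h
      -- A missing branch is the supremum of the empty set, `⊥`, which no real lower bound admits.
      have hne : ∃ k ∈ m.wavenumbers ω, (A k).encard + 1 = (ℓ : ℕ∞) := by
        by_contra! hcon
        have : m.branch ℓ ω = ⊥ := by
          rw [branch, sSup_eq_bot]
          rintro x ⟨k, hk, hkℓ, -⟩
          exact absurd hkℓ (hcon k hk)
        rw [this] at h
        exact EReal.coe_ne_bot _ (le_bot_iff.1 h)
      obtain ⟨k, hk, hkℓ⟩ := hne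
      rw [hbranch ℓ k hk hkℓ, EReal.coe_le_coe_iff] at h
      refine ⟨k, ⟨hk, h⟩, ?_⟩
      rw [← (hAfin k ⟨hk, h⟩).cast_ncard_eq] at hkℓ
      exact_mod_cast hkℓ
    · rintro ⟨k, hk, rfl⟩
      refine ⟨Nat.le_add_left _ _, ?_⟩
      rw [hdiv, hbranch _ k hk.1, EReal.coe_le_coe_iff]
      · exact hk.2
      · rw [← (hAfin k hk).cast_ncard_eq]; push_cast; rfl
  rw [N, hset]
  refine Set.InjOn.ncard_image fun k hk k' hk' e => ?_
  simp only [Nat.add_right_cancel_iff] at e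
  rcases lt_trichotomy k k' with h | h | h
  · have := hmono k k' hk'.1 h (hAfin k hk); omega
  · exact h
  · have := hmono k' k hk.1 h (hAfin k' hk'); omega

/-- For wavenumbers above the cutoff `ω / C_∞`, the dispersion relation says that the Prüfer angle
matches the impedance of the half-space modulo `π`. -/
theorem f_eq_zero_iff {ω k : ℝ} {L : ℝ → ℂ} (h : m.IsPruferLog ω (Fin.last n) L)
    (hk : 0 ≤ m.νSq (Fin.last n) ω k) :
    m.f ω k = 0 ↔ Real.sin ((L k).im +
      Real.arctan (m.μ (Fin.last n) * √(m.νSq (Fin.last n) ω k))) = 0 := by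
  set a := m.μ (Fin.last n) * √(m.νSq (Fin.last n) ω k)
  have hf : m.f ω k =
      ((Real.exp (L k).re * (a * Real.cos (L k).im + Real.sin (L k).im) : ℝ) : ℂ) := by
    rw [f, h.eq, ν_eq_lowerSqrt, lowerSqrt_of_nonneg hk]
    simp only [Matrix.cons_val_zero, Matrix.cons_val_one, Complex.exp_re, Complex.exp_im]
    simp only [a]
    push_cast
    ring
  have hcos := Real.cos_arctan_pos a
  have hsin : Real.sin (Real.arctan a) = a * Real.cos (Real.arctan a) := by
    rw [← Real.tan_mul_cos hcos.ne', Real.tan_arctan]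
  rw [hf, Complex.ofReal_eq_zero, mul_eq_zero, or_iff_right (Real.exp_pos _).ne', Real.sin_add,
    hsin]
  rw [show Real.sin (L k).im * Real.cos (Real.arctan a) +
      Real.cos (L k).im * (a * Real.cos (Real.arctan a)) =
      Real.cos (Real.arctan a) * (a * Real.cos (L k).im + Real.sin (L k).im) by ring,
    mul_eq_zero, or_iff_right hcos.ne']

theorem C0_le (j : Fin (n + 1)) : m.C0 ≤ m.C j := Finset.inf'_le _ (Finset.mem_univ j)

theorem C0_pos : 0 < m.C0 := (Finset.lt_inf'_iff _).2 fun j _ => m.C_pos j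

theorem sqrt_neg_νSq_mul {ω : ℝ} (hω : 0 ≤ ω) (y : ℝ) (j : Fin (n + 1)) :
    √(-m.νSq j ω (y * ω)) = ω * √((m.C j ^ 2)⁻¹ - y ^ 2) := by
  have e : -m.νSq j ω (y * ω) = ω ^ 2 * ((m.C j ^ 2)⁻¹ - y ^ 2) := by
    unfold νSq; ring
  rw [e, Real.sqrt_mul (sq_nonneg _), Real.sqrt_sq hω]

/-- The semiclassical counting estimate, with a remainder bounded by the number of layers. -/
theorem abs_N_sub_le (hn : n ≠ 0) {ω y : ℝ} (hω : 0 < ω)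
    (hy : y ∈ Set.Ico (1 / m.Cinf) (1 / m.C0)) :
    |(m.N ω y : ℝ) - ω / Real.pi *
      ∑ i : Fin n, √((m.C i.castSucc ^ 2)⁻¹ - y ^ 2) * m.width i| ≤ n + 2 := by
  have hpi := Real.pi_pos
  have hCinf : 0 < m.Cinf := m.C_pos _
  have hC0 := m.C0_pos
  obtain ⟨L, hL⟩ := m.exists_isPruferLog ω (Fin.last n)
  have hLc := hL.continuous
  set α : ℝ → ℝ := fun k => Real.arctan (m.μ (Fin.last n) * √(m.νSq (Fin.last n) ω k))
  have hαc : Continuous α :=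
    Real.continuous_arctan.comp (continuous_const.mul (m.continuous_νSq _ ω).sqrt)
  have hα : ∀ k, α k ∈ Set.Ico 0 (Real.pi / 2) := fun k =>
    ⟨Real.arctan_nonneg.2 (mul_nonneg (m.μ_pos _).le (Real.sqrt_nonneg _)),
      Real.arctan_lt_pi_div_two _⟩
  have hy0 : 0 < y := (one_div_pos.2 hCinf).trans_le hy.1
  have ha0 : 0 < y * ω := mul_pos hy0 hω
  have hcut : ∀ k, y * ω ≤ k → 0 ≤ m.νSq (Fin.last n) ω k := fun k hk => by
    rw [νSq_nonneg_iff m _ hω.le (ha0.le.trans hk)]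
    refine le_trans ?_ hk
    have := mul_le_mul_of_nonneg_right hy.1 hω.le
    rwa [one_div_mul_eq_div] at this
  have hab : y * ω ≤ ω / m.C0 := by
    have := mul_le_mul_of_nonneg_right hy.2.le hω.le
    rwa [one_div_mul_eq_div] at this
  have hαmono : StrictMonoOn α (Set.Ici (y * ω)) := fun k hk k' hk' hlt => by
    have hk0 : 0 < k := ha0.trans_le hk
    refine Real.arctan_strictMono ?_
    refine mul_lt_mul_of_pos_left ?_ (m.μ_pos _)
    refine Real.sqrt_lt_sqrt (hcut k hk) ?_
    unfold νSq
    have := pow_lt_pow_left₀ hlt hk0.le two_ne_zero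
    linarith
  have hlast : Fin.last n ≠ 0 := fun h => hn (by simpa using congrArg Fin.val h)
  have hLmono : MonotoneOn (fun k => (L k).im) (Set.Ici (y * ω)) :=
    (hL.im_monotoneOn m hlast).mono fun k hk => ha0.trans_le hk
  have hb : ∀ k, ω / m.C0 ≤ k → (L k).im + α k ∈ Set.Ioo 0 Real.pi := fun k hk => by
    have hk0 : 0 < k := ha0.trans_le (hab.trans hk)
    have h1 := hL.sector k fun i => by
      rw [νSq_nonneg_iff m _ hω.le hk0.le]
      exact (div_le_div_of_nonneg_left hω.le hC0 (m.C0_le _)).trans hk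
    have h2 := hα k
    -- The sector allows a zero Prüfer angle, so strict positivity must come from the half-space
    -- term, using `y < 1/C_0`.
    have h3 : 0 < α k := by
      have hlt : y * ω < ω / m.C0 := by
        have := mul_lt_mul_of_pos_right hy.2 hω
        rwa [one_div_mul_eq_div] at this
      exact (hα _).1.trans_lt
        (hαmono (Set.mem_Ici.2 le_rfl) (Set.mem_Ici.2 (hab.trans hk)) (hlt.trans_le hk))
    exact ⟨by linarith [h1.1], by linarith [h1.2, h2.2]⟩
  have hset : {k | k ∈ m.wavenumbers ω ∧ y * ω ≤ k} =
      {k | Real.sin ((L k).im + α k) = 0 ∧ y * ω ≤ k} := by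
    ext k
    refine and_congr_left fun hk => ?_
    exact m.f_eq_zero_iff hL (hcut k hk)
  obtain ⟨hfin, hcard⟩ := finite_and_abs_ncard_sin_eq_zero_add_le
    (Φ := fun k => (L k).im + α k) (by fun_prop) hab (hLmono.add_strictMono hαmono) hb
  rw [← hset] at hfin hcard
  rw [← m.N_eq_ncard hω hfin] at hcard
  have hrot := hL.rotation (y * ω)
  have hsum : ∑ i : Fin n with i.castSucc < Fin.last n,
      √(-m.νSq i.castSucc ω (y * ω)) * m.width i =
      ω * ∑ i : Fin n, √((m.C i.castSucc ^ 2)⁻¹ - y ^ 2) * m.width i := by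
    rw [Finset.filter_true_of_mem fun i _ => i.castSucc_lt_last, Finset.mul_sum]
    exact Finset.sum_congr rfl fun i _ => by rw [m.sqrt_neg_νSq_mul hω.le]; ring
  rw [hsum, Fin.val_last] at hrot
  set A := ∑ i : Fin n, √((m.C i.castSucc ^ 2)⁻¹ - y ^ 2) * m.width i
  -- The remainder `n + 2` is made of `n` from the rotation through the layers, `1` from the
  -- arctangent and `1` from rounding in the count.
  have hrot' : |((L (y * ω)).im + ω * A) / Real.pi| ≤ n := by
    rwa [abs_div, abs_of_pos hpi, div_le_iff₀ hpi]
  have hα' : |α (y * ω) / Real.pi| ≤ 1 := by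
    rw [abs_of_nonneg (div_nonneg (hα _).1 hpi.le), div_le_one hpi]
    linarith [(hα (y * ω)).2]
  rw [abs_le] at *
  have e : ((L (y * ω)).im + α (y * ω)) / Real.pi =
      ((L (y * ω)).im + ω * A) / Real.pi - ω / Real.pi * A + α (y * ω) / Real.pi := by
    field_simp
    ring
  simp only [e] at hcard
  constructor <;> linarith [hcard.1, hcard.2, hrot'.1, hrot'.2, hα'.1, hα'.2]

/-! ### Asymptotic equivalence and selection of the contributing layers -/

-- For fixed `y` the remainder is bounded in `ω`, while `A > 0` makes the main term tend to
-- infinity.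
open Filter Asymptotics in
theorem isEquivalent_N (hn : n ≠ 0) {y A : ℝ} (hy : y ∈ Set.Ico (1 / m.Cinf) (1 / m.C0))
    (hA : ∑ i : Fin n, √((m.C i.castSucc ^ 2)⁻¹ - y ^ 2) * m.width i = A) (hA0 : 0 < A) :
    IsEquivalent atTop (fun ω : ℝ => (m.N ω y : ℝ)) (fun ω : ℝ => ω / Real.pi * A) := by
  have h1 : (fun ω : ℝ => (m.N ω y : ℝ) - ω / Real.pi * A) =O[atTop] fun _ => (1 : ℝ) := by
    refine IsBigO.of_bound (n + 2) ?_
    filter_upwards [eventually_gt_atTop 0] with ω hω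
    rw [norm_one, mul_one, Real.norm_eq_abs, ← hA]
    exact m.abs_N_sub_le hn hω hy
  refine h1.trans_isLittleO (isLittleO_const_left.2 (Or.inr ?_))
  refine tendsto_norm_atTop_atTop.comp ?_
  exact (tendsto_id.atTop_div_const Real.pi_pos).atTop_mul_const hA0

theorem norm_νbar {j : Fin (n + 1)} {y : ℝ} (hy0 : 0 ≤ y) (hy : y ≤ 1 / m.C j) :
    ‖m.νbar j y‖ = √((m.C j ^ 2)⁻¹ - y ^ 2) := by
  have : y ^ 2 ≤ (m.C j ^ 2)⁻¹ := by
    rw [← inv_pow, ← one_div]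
    exact pow_le_pow_left₀ hy0 hy 2
  rw [νbar, norm_lowerSqrt_of_nonpos (by linarith), neg_sub]

theorem sqrt_eq_zero_of_one_div_le {j : Fin (n + 1)} {y : ℝ} (hy : 1 / m.C j ≤ y) :
    √((m.C j ^ 2)⁻¹ - y ^ 2) = 0 := by
  refine Real.sqrt_eq_zero_of_nonpos (sub_nonpos.2 ?_)
  rw [← inv_pow, ← one_div]
  exact pow_le_pow_left₀ (one_div_pos.2 (m.C_pos j)).le hy 2

theorem sqrt_pos_of_lt_one_div {j : Fin (n + 1)} {y : ℝ} (hy0 : 0 ≤ y) (hy : y < 1 / m.C j) :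
    0 < √((m.C j ^ 2)⁻¹ - y ^ 2) := by
  refine Real.sqrt_pos.2 (sub_pos.2 ?_)
  rw [← inv_pow, ← one_div]
  exact pow_lt_pow_left₀ hy hy0 two_ne_zero

theorem C_eq_C0_of_monotone {σ : Equiv.Perm (Fin (n + 1))} (hσ : Monotone fun j => m.C (σ j)) :
    m.C (σ 0) = m.C0 := by
  refine le_antisymm ?_ (m.C0_le _)
  refine Finset.le_inf' _ _ fun j _ => ?_
  simpa using hσ (Fin.zero_le (σ.symm j))

/-- If all layers of finite thickness but `i₀` are too fast to carry oscillations at the slowness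
`y`, only `i₀` contributes to the counting function. -/
theorem isEquivalent_N_of_single {y : ℝ} (hy : y ∈ Set.Ico (1 / m.Cinf) (1 / m.C0)) {i₀ : Fin n}
    (h0 : m.C i₀.castSucc = m.C0) (h : ∀ i, i ≠ i₀ → 1 / m.C i.castSucc ≤ y) :
    Asymptotics.IsEquivalent Filter.atTop (fun ω : ℝ => (m.N ω y : ℝ))
      (fun ω : ℝ => ω / Real.pi * (‖m.νbar i₀.castSucc y‖ * (m.T i₀.castSucc).toReal)) := by
  have hy0 : 0 ≤ y := (one_div_pos.2 (m.C_pos (Fin.last n))).le.trans hy.1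
  have hlt : y < 1 / m.C i₀.castSucc := h0 ▸ hy.2
  rw [T_castSucc, EReal.toReal_coe, m.norm_νbar hy0 hlt.le]
  refine m.isEquivalent_N (Fin.pos i₀).ne' hy ?_
    (mul_pos (m.sqrt_pos_of_lt_one_div hy0 hlt) (m.width_pos i₀))
  refine Finset.sum_eq_single i₀ (fun i _ hi => ?_) (by simp)
  rw [m.sqrt_eq_zero_of_one_div_le (h i hi), zero_mul]

end LayeredMedium

theorem mainTheorem2 (n : ℕ) (m : LayeredMedium n) (hC : m.C0 < m.Cinf)
    (σ : Equiv.Perm (Fin (n + 1))) (hσ : Monotone (fun j => m.C (σ j))) :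
    (n = 1 → ∀ y ∈ Set.Ico (1 / m.Cinf) (1 / m.C0),
      Asymptotics.IsEquivalent Filter.atTop (fun ω : ℝ => (m.N ω y : ℝ))
        (fun ω : ℝ => ω / Real.pi * (‖m.νbar (σ 0) y‖ * (m.T (σ 0)).toReal))) ∧
    (n = 2 → ∀ y ∈ Set.Ico (1 / m.Cinf) (1 / m.C0),
      (y ∈ Set.Ico (1 / m.C (σ 1)) (1 / m.C0) →
        Asymptotics.IsEquivalent Filter.atTop (fun ω : ℝ => (m.N ω y : ℝ))
          (fun ω : ℝ => ω / Real.pi * (‖m.νbar (σ 0) y‖ * (m.T (σ 0)).toReal))) ∧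
      (y ∈ Set.Ico (1 / m.Cinf) (1 / m.C (σ 1)) →
        Asymptotics.IsEquivalent Filter.atTop (fun ω : ℝ => (m.N ω y : ℝ))
          (fun ω : ℝ => ω / Real.pi * (‖m.νbar (σ 0) y‖ * (m.T (σ 0)).toReal +
            ‖m.νbar (σ 1) y‖ * (m.T (σ 1)).toReal)))) ∧
    (3 ≤ n → m.C0 < m.C (σ 1) → ∀ y ∈ Set.Ico (1 / m.C (σ 1)) (1 / m.C0),
      Asymptotics.IsEquivalent Filter.atTop (fun ω : ℝ => (m.N ω y : ℝ))
        (fun ω : ℝ => ω / Real.pi * (‖m.νbar (σ 0) y‖ * (m.T (σ 0)).toReal))) := by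
  have hC0 := m.C_eq_C0_of_monotone hσ
  have hCinf : 0 < m.Cinf := m.C_pos _
  -- Since `C_0 < C_∞`, the slowest layer is not the half-space; its thickness is finite and
  -- `toReal` takes no default value.
  obtain ⟨i₀, hi₀⟩ : ∃ i₀ : Fin n, i₀.castSucc = σ 0 :=
    Fin.exists_castSucc_eq.2 fun h => hC.ne (by rw [← hC0, h, LayeredMedium.Cinf])
  rw [← hi₀] at hC0 ⊢
  -- Any other finite layer has sorted position at least `1`, hence velocity at least `C (σ 1)`.
  have hfast : ∀ y, n ≠ 0 → 1 / m.C (σ 1) ≤ y → ∀ i, i ≠ i₀ → 1 / m.C i.castSucc ≤ y := by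
    intro y hn hy i hi
    refine le_trans (one_div_le_one_div_of_le (m.C_pos _) ?_) hy
    have hne : σ.symm i.castSucc ≠ 0 := fun h => hi <| by
      rw [Equiv.symm_apply_eq, ← hi₀] at h
      exact Fin.castSucc_injective n h
    have h1 : 1 ≤ σ.symm i.castSucc := by
      obtain ⟨n, rfl⟩ := Nat.exists_eq_succ_of_ne_zero hn
      exact Fin.one_le_of_ne_zero hne
    simpa using hσ h1
  refine ⟨?_, ?_, ?_⟩
  · rintro rfl y hy
    exact m.isEquivalent_N_of_single hy hC0 fun i hi => absurd (Subsingleton.elim i i₀) hi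
  · rintro rfl y hy
    refine ⟨fun hy1 => m.isEquivalent_N_of_single hy hC0 (hfast y two_ne_zero hy1.1), fun hy1 => ?_⟩
    -- If `σ 1` were the half-space, the interval containing `y` would be empty.
    obtain ⟨i₁, hi₁⟩ : ∃ i₁ : Fin 2, i₁.castSucc = σ 1 :=
      Fin.exists_castSucc_eq.2 fun h => by
        have := hy1.1.trans_lt hy1.2
        rw [h, LayeredMedium.Cinf] at this
        exact lt_irrefl _ this
    have hne : i₀ ≠ i₁ := fun h => by
      rw [h, hi₁] at hi₀
      exact absurd (σ.injective hi₀) (by decide)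
    rw [← hi₁] at hy1 ⊢
    have hy0 : 0 ≤ y := (one_div_pos.2 hCinf).le.trans hy.1
    have hlt : y < 1 / m.C i₀.castSucc := hC0 ▸ hy.2
    rw [m.T_castSucc, m.T_castSucc, EReal.toReal_coe, EReal.toReal_coe, m.norm_νbar hy0 hlt.le,
      m.norm_νbar hy0 hy1.2.le]
    refine m.isEquivalent_N two_ne_zero hy ?_
      (add_pos (mul_pos (m.sqrt_pos_of_lt_one_div hy0 hlt) (m.width_pos i₀))
        (mul_pos (m.sqrt_pos_of_lt_one_div hy0 hy1.2) (m.width_pos i₁)))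
    have huniv : (Finset.univ : Finset (Fin 2)) = {i₀, i₁} :=
      (Finset.eq_univ_of_card _ (by rw [Finset.card_pair hne, Fintype.card_fin])).symm
    rw [huniv, Finset.sum_pair hne]
  · intro hn _ y hy
    refine m.isEquivalent_N_of_single ⟨?_, hy.2⟩ hC0 (hfast y (by omega) hy.1)
    -- The half-space is not `σ 0`, so `C (σ 1) ≤ C_∞` and the slowness is above the cutoff.
    refine le_trans (one_div_le_one_div_of_le (m.C_pos _) ?_) hy.1
    have hne : σ.symm (Fin.last n) ≠ 0 := fun h => by
      rw [Equiv.symm_apply_eq, ← hi₀] at h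
      exact (Fin.castSucc_lt_last i₀).ne h.symm
    have h1 : 1 ≤ σ.symm (Fin.last n) := by
      obtain ⟨n, rfl⟩ := Nat.exists_eq_succ_of_ne_zero (by omega : n ≠ 0)
      exact Fin.one_le_of_ne_zero hne
    simpa [LayeredMedium.Cinf] using hσ h1
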